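/- Theorem 4 (Strong amenability at 1). Every abelian Polish group $G$ is strongly amenable at $1$. Here, for a sequence $(\mu_k)$ of Borel probability measures on $G$, a Borel probability measure $\sigma$ is called a Solecki measure for $(\mu_k)$, with associated measures $\sigma_k$, if the $\sigma_k$ are Borel probability measures with $\sigma_k\ll\mu_k$ for every $k$ and $(\sigma_k*\sigma)(K)\to\sigma(K)$ as $k\to\infty$ for every compact $K\subseteq G$. The group $G$ is amenable at $1$ if every sequence $(\mu_k)$ of Borel probability measures with $1\in\operatorname{supp}\mu_k$ for all $k$ has a Solecki measure. For a left-invariant metric $d$ generating the topology of $G$, write $\|x\|=d(x,1)$; a sequence $t=(t_k)_{k\ge1}$ in $G$ is a regular null sequence if $t_k\to1$, $t_k\ne1$ for infinitely many $k$, $\|t_k\|$ is non-increasing, and $\|t_k\|\le 1/(2^k(k+1))$ for all $k\ge1$. Put $\mu_k(t)=\sum_{m\ge k}2^{k-1-m}\delta_{t_m^{-1}}$. A sequence of probability measures of the form $\nu_k=\sum_{m\ge k}a_{km}\delta_{t_m^{-1}}$ with $a_{km}\ge0$ and $\sum_{m\ge k}a_{km}=1$ has the concentration property if, for some such choice of coefficients,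 there are an index $j\ge0$ and $\alpha>0$ with $a_{k,k+j}\ge\alpha$ for all large $k$. The group $G$ is strongly amenable at $1$ if it is amenable at $1$ and, for every left-invariant metric generating its topology and every regular null sequence $t$, there is a Solecki measure $\sigma(t)$ for the sequence $(\mu_k(t))$ whose associated measures $\sigma_k(t)\ll\mu_k(t)$ have the concentration property. Moreover, for each regular null sequence $t$ in the abelian Polish group $G$ one may take $\sigma_k(t)=\mu_k(t)$ and $\sigma(t)=\ast_{k=1}^{\infty}\rho_k$, where $\rho_k=\frac1{k+1}\sum_{i=0}^{k}\sigma_k(t)^{i}$ (convolution powers, with $\sigma_k(t)^0=\delta_1$): the partial convolutions $\rho_1*\cdots*\rho_n$ converge weakly to a probability measure $\sigma(t)$, which is a Solecki measure for $(\mu_k(t))$ with associated measures $\mu_k(t)$, and these have the concentration property. -/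

import Mathlib

open Filter Topology MeasureTheory
open scoped NNReal ENNReal BoundedContinuousFunction

noncomputable section

namespace StrongAmenability

/-- `σ` is a Solecki measure for the sequence `μ`, with associated measures `ν k ≪ μ k`: all are
probability measures and `(ν k ∗ σ)(K) → σ(K)` for every compact `K`.  (On a Polish group every
Borel probability measure is inner and outer regular, so no regularity clause is needed.) -/
structure IsSoleckiMeasure {G : Type*} [Group G] [TopologicalSpace G] [MeasurableSpace G]
    (μ : ℕ → Measure G) (σ : Measure G) (ν : ℕ → Measure G) : Prop where
  isProbabilityMeasure : IsProbabilityMeasure σ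
  isProbabilityMeasure_assoc : ∀ k, IsProbabilityMeasure (ν k)
  absolutelyContinuous : ∀ k, ν k ≪ μ k
  tendsto_mconv : ∀ K : Set G, IsCompact K →
    Tendsto (fun k => (ν k ∗ₘ σ) K) atTop (𝓝 (σ K))

/-- Amenability at the identity: every sequence of Borel probability measures having the identity
in their supports admits a Solecki measure with associated measures. -/
def AmenableAtOne (G : Type*) [Group G] [TopologicalSpace G] [MeasurableSpace G] : Prop :=
  ∀ μ : ℕ → Measure G, (∀ k, IsProbabilityMeasure (μ k)) → (∀ k, (1 : G) ∈ (μ k).support) →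
    ∃ (σ : Measure G) (ν : ℕ → Measure G), IsSoleckiMeasure μ σ ν

/-- The metric `d` is left-invariant and generates the given topology of `G`.  Its group-norm is
`‖x‖ = d (x, 1)`. -/
structure IsLeftInvariantMetric {G : Type*} [Group G] [τ : TopologicalSpace G]
    (d : MetricSpace G) : Prop where
  topology_eq : d.toUniformSpace.toTopologicalSpace = τ
  dist_mul_left : ∀ g x y : G, d.dist (g * x) (g * y) = d.dist x y

/-- Regular null sequences `t 1, t 2, …` for the group-norm of the metric `d`: the sequence
converges to `1`, is different from `1` infinitely often, has non-increasing norms, and satisfies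
`‖t k‖ ≤ 1 / (2 ^ k * (k + 1))`.  The indices are `1, 2, …`; nothing is required of `t 0`. -/
structure IsRegularNullSeq {G : Type*} [Group G] [TopologicalSpace G]
    (d : MetricSpace G) (t : ℕ → G) : Prop where
  tendsto_one : Tendsto t atTop (𝓝 1)
  nontrivial : ∃ᶠ k in atTop, t k ≠ 1
  norm_antitone : ∀ k l : ℕ, 1 ≤ k → k ≤ l → d.dist (t l) 1 ≤ d.dist (t k) 1
  norm_le : ∀ k : ℕ, 1 ≤ k → d.dist (t k) 1 ≤ 1 / ((2 : ℝ) ^ k * ((k : ℝ) + 1))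

/-- The measure `μ_k(t) = 2 ^ (k - 1) ∑_{m ≥ k} 2 ^ (-m) δ_{t_m⁻¹}
= (1/2) δ_{t_k⁻¹} + (1/4) δ_{t_{k+1}⁻¹} + ⋯`. -/
def seqMeasure {G : Type*} [Group G] [MeasurableSpace G] (t : ℕ → G) (k : ℕ) : Measure G :=
  Measure.sum fun i : ℕ => ((2 : ℝ≥0∞)⁻¹ ^ (i + 1)) • Measure.dirac (t (k + i))⁻¹

/-- The concentration property of an array `a k m` (of which only `m ≥ k` matters):
for some index `j` and some `α > 0`, `a k (k + j) ≥ α` for all large `k`. -/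
def ConcentrationProperty (a : ℕ → ℕ → ℝ≥0) : Prop :=
  ∃ j : ℕ, ∃ α : ℝ≥0, 0 < α ∧ ∀ᶠ k in atTop, α ≤ a k (k + j)

/-- The concentration property along `t` of a sequence of measures
`ν k = ∑_{m ≥ k} a k m δ_{t_m⁻¹}`, where each `(a k m)_{m ≥ k}` is non-negative with sum `1`. -/
def HasConcentrationProperty {G : Type*} [Group G] [MeasurableSpace G]
    (t : ℕ → G) (ν : ℕ → Measure G) : Prop :=
  ∃ a : ℕ → ℕ → ℝ≥0,
    (∀ k, HasSum (fun i : ℕ => a k (k + i)) 1) ∧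
    (∀ k, ν k = Measure.sum fun i : ℕ => (a k (k + i) : ℝ≥0∞) • Measure.dirac (t (k + i))⁻¹) ∧
    ConcentrationProperty a

/-- Strong amenability at the identity: `G` is amenable at `1` and, for every regular null
sequence `t` (for any left-invariant metric generating the topology), there is a Solecki measure
for the sequence `μ_k(t)` whose associated measures have the concentration property. -/
def StronglyAmenableAtOne (G : Type*) [Group G] [TopologicalSpace G] [MeasurableSpace G] : Prop :=
  AmenableAtOne G ∧
    ∀ d : MetricSpace G, IsLeftInvariantMetric d → ∀ t : ℕ → G, IsRegularNullSeq d t →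
      ∃ (σ : Measure G) (ν : ℕ → Measure G),
        IsSoleckiMeasure (seqMeasure t) σ ν ∧ HasConcentrationProperty t ν

/-- Convolution powers, with `convPow μ 0 = δ_1`. -/
def convPow {G : Type*} [Group G] [MeasurableSpace G] (μ : Measure G) : ℕ → Measure G
  | 0 => Measure.dirac 1
  | i + 1 => convPow μ i ∗ₘ μ

/-- The average `ρ_k = (1 / (k + 1)) ∑_{i = 0}^{k} (ν k)^i` of convolution powers. -/
def avgConvPow {G : Type*} [Group G] [MeasurableSpace G] (ν : ℕ → Measure G) (k : ℕ) :
    Measure G :=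
  ((k + 1 : ℕ) : ℝ≥0∞)⁻¹ • ∑ i ∈ Finset.range (k + 1), convPow (ν k) i

/-- The partial convolution `ρ 1 ∗ ρ 2 ∗ ⋯ ∗ ρ n` (`δ_1` for `n = 0`). -/
def partialConv {G : Type*} [Group G] [MeasurableSpace G] (ρ : ℕ → Measure G) : ℕ → Measure G
  | 0 => Measure.dirac 1
  | n + 1 => partialConv ρ n ∗ₘ ρ (n + 1)

/-- `σ` is the infinite convolution `∗_{k ≥ 1} ρ k`: a probability measure that is the weak limit
of the partial convolutions. -/
def IsInfiniteConvolution {G : Type*} [Group G] [TopologicalSpace G] [MeasurableSpace G]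
    (ρ : ℕ → Measure G) (σ : Measure G) : Prop :=
  IsProbabilityMeasure σ ∧
    ∀ f : G →ᵇ ℝ, Tendsto (fun n => ∫ x, f x ∂(partialConv ρ n)) atTop (𝓝 (∫ x, f x ∂σ))

end StrongAmenability

end

namespace StrongAmenability

/-! ### Completeness of invariant metrics -/

section Completeness

/-! Let `ρ_k` be the average of the powers `0, …, k` of `ν_k`. Convolving with `ν_k` shifts the
powers, so the difference telescopes and `ν_k ∗ ρ_k` is within `1/(k+1)` of `ρ_k` on every set. By
commutativity `ρ_k` can be pulled to the front of the infinite convolution, `σ = ρ_k ∗ τ`, so `σ`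
inherits this bound (`abs_real_mconv_avgConvPow_sub_le`,
`exists_eq_mconv_of_isInfiniteConvolution`).

The convolution converges when `ν_k` lives within `1/(2^k (k+1))` of `1`: then `ρ_k` lives within
`2^(-k)`, and products of independent variables with laws `ρ_k` are almost surely Cauchy for an
invariant metric, which is complete by Klee's theorem.

Regular null sequences place `μ_k(t)` in these balls. For general `μ_k`, conditioning on the balls
does; they have positive mass because `1` lies in the support. -/

theorem exists_completing_function (X : Type*) [TopologicalSpace X]
    [TopologicalSpace.IsCompletelyMetrizableSpace X] :
    ∃ D : X → X → ℝ, (∀ x, Tendsto (D x) (𝓝 x) (𝓝 0)) ∧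
      ∀ u : ℕ → X, (∀ n, D (u n) (u (n + 1)) ≤ (1 / 2 : ℝ) ^ n) →
        ∃ x, Tendsto u atTop (𝓝 x) := by
  let := TopologicalSpace.upgradeIsCompletelyMetrizable X
  refine ⟨dist, fun x => ?_, fun u hu => ?_⟩
  · have : Continuous fun y => dist x y := by fun_prop
    simpa using this.tendsto x
  · refine cauchySeq_tendsto_of_complete (cauchySeq_of_le_geometric (1 / 2) 1 (by norm_num) ?_)
    simpa using hu

/-- Klee's theorem in the commutative case: an invariant compatible metric on a completely
metrizable abelian group is complete. -/
theorem completeSpace_of_isIsometricSMul (G : Type*) [CommGroup G] [MetricSpace G]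
    [IsIsometricSMul G G] [IsTopologicalGroup G]
    [TopologicalSpace.IsCompletelyMetrizableSpace G] : CompleteSpace G := by
  refine Metric.complete_of_cauchySeq_tendsto fun p hp => ?_
  -- `D` is a complete metric for the topology, kept as a bare function so as not to compete with
  -- the invariant metric.
  obtain ⟨D, hD, hDlim⟩ := exists_completing_function G
  have hR : ∀ (x : G) (n : ℕ), ∃ r > 0, ∀ y, dist y x < r → D x y ≤ (1 / 2 : ℝ) ^ n := by
    intro x n
    have h := (hD x).eventually (gt_mem_nhds (show (0 : ℝ) < (1 / 2 : ℝ) ^ n by positivity))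
    obtain ⟨r, hr, h⟩ := Metric.eventually_nhds_iff.1 h
    exact ⟨r, hr, fun y hy => (h hy).le⟩
  choose R hR0 hR using hR
  -- Positivity of `r` sits inside, so that `T` is total and usable in the recursion.
  have hT : ∀ r : ℝ, ∃ N : ℕ, 0 < r → ∀ m ≥ N, dist (p m) (p N) < r := by
    intro r
    by_cases hr : 0 < r
    · obtain ⟨N, hN⟩ := Metric.cauchySeq_iff'.1 hp r hr
      exact ⟨N, fun _ => hN⟩
    · exact ⟨0, fun h => absurd h hr⟩
  choose T hT using hT
  -- Successive terms satisfy `a (n+1) * a n = p (N (n+1))`. Hence `a (n+2)` and `a n` are as close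
  -- as two late terms of `p`, and `N` grows fast enough to make them `D`-close. The even and odd
  -- subsequences converge, and the product of their limits is the limit of a subsequence of `p`.
  let s : ℕ → G × ℕ := fun n => Nat.rec (1, 0) (fun n q =>
    (p (max (q.2 + 1) (T (R q.1 n / 2))) * q.1⁻¹, max (q.2 + 1) (T (R q.1 n / 2)))) n
  set a : ℕ → G := fun n => (s n).1 with ha
  set N : ℕ → ℕ := fun n => (s n).2 with hN
  have hNs : ∀ n, N (n + 1) = max (N n + 1) (T (R (a n) n / 2)) := fun n => rfl
  have has : ∀ n, a (n + 1) = p (N (n + 1)) * (a n)⁻¹ := fun n => rfl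
  have hNmono : StrictMono N := strictMono_nat_of_lt_succ fun n => by rw [hNs]; omega
  have hprod : ∀ n, a (n + 1) * a n = p (N (n + 1)) := fun n => by rw [has]; simp
  have hstep : ∀ n, D (a n) (a (n + 2)) ≤ (1 / 2 : ℝ) ^ n := by
    intro n
    refine hR _ _ _ ?_
    have e1 : a (n + 2) = p (N (n + 2)) * (a (n + 1))⁻¹ := has (n + 1)
    have e2 : a n = p (N (n + 1)) * (a (n + 1))⁻¹ := by rw [← hprod]; simp
    have e3 : dist (a (n + 2)) (a n) = dist (p (N (n + 2))) (p (N (n + 1))) := by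
      rw [e1]; conv_lhs => rw [e2]
      simp
    rw [e3]
    have hr : 0 < R (a n) n / 2 := half_pos (hR0 _ _)
    have h1 := hT _ hr (N (n + 1)) (by rw [hNs]; omega)
    have h2 := hT _ hr (N (n + 2)) (by
      have := hNmono (show n + 1 < n + 2 by omega)
      rw [hNs n] at this; omega)
    have := dist_triangle_right (p (N (n + 2))) (p (N (n + 1))) (p (T (R (a n) n / 2)))
    linarith
  have hpow : ∀ n : ℕ, (1 / 2 : ℝ) ^ (2 * n) ≤ (1 / 2) ^ n ∧ (1 / 2 : ℝ) ^ (2 * n + 1) ≤ (1 / 2) ^ n :=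
    fun n => ⟨pow_le_pow_of_le_one (by norm_num) (by norm_num) (by omega),
      pow_le_pow_of_le_one (by norm_num) (by norm_num) (by omega)⟩
  obtain ⟨x, hx⟩ := hDlim (fun n => a (2 * n)) fun n => (hstep (2 * n)).trans (hpow n).1
  obtain ⟨y, hy⟩ := hDlim (fun n => a (2 * n + 1)) fun n =>
    (hstep (2 * n + 1)).trans (hpow n).2
  have hNtop : Tendsto (fun n => N (2 * n + 1)) atTop atTop :=
    hNmono.tendsto_atTop.comp
      (tendsto_atTop_mono (fun n => show id n ≤ 2 * n + 1 by simp only [id]; omega) tendsto_id)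
  refine ⟨y * x, tendsto_nhds_of_cauchySeq_of_subseq hp hNtop ?_⟩
  · exact (hy.mul hx).congr fun n => hprod (2 * n)

theorem exists_tendsto_prod_range {G : Type*} [CommGroup G] [MetricSpace G]
    [IsIsometricSMul G G] [CompleteSpace G] (x : ℕ → G)
    (hx : ∀ n, dist (x n) 1 ≤ (1 / 2 : ℝ) ^ n) :
    ∃ y, Tendsto (fun n => ∏ i ∈ Finset.range n, x i) atTop (𝓝 y) := by
  refine cauchySeq_tendsto_of_complete
    (cauchySeq_of_le_geometric (1 / 2) 1 (by norm_num) fun n => ?_)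
  have h := dist_mul_left (∏ i ∈ Finset.range n, x i) (x n) 1
  rw [mul_one] at h
  rw [Finset.prod_range_succ, one_mul, dist_comm, h]
  exact hx n

end Completeness

/-! ### Convolution identities and the telescoping estimate -/

section Convolution

variable {G : Type*} [CommGroup G] [MeasurableSpace G]

instance isProbabilityMeasure_partialConv [MeasurableMul₂ G] (ρ : ℕ → Measure G)
    [∀ k, IsProbabilityMeasure (ρ k)] (n : ℕ) : IsProbabilityMeasure (partialConv ρ n) := by
  induction n with
  | zero => unfold partialConv; infer_instance
  | succ n ih => unfold partialConv; infer_instance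

instance isProbabilityMeasure_convPow [MeasurableMul₂ G] (μ : Measure G)
    [IsProbabilityMeasure μ] (n : ℕ) : IsProbabilityMeasure (convPow μ n) := by
  induction n with
  | zero => unfold convPow; infer_instance
  | succ n ih => unfold convPow; infer_instance

instance isProbabilityMeasure_avgConvPow [MeasurableMul₂ G] (ν : ℕ → Measure G)
    [∀ k, IsProbabilityMeasure (ν k)] (k : ℕ) : IsProbabilityMeasure (avgConvPow ν k) := by
  constructor
  simp only [avgConvPow, Measure.smul_apply, Measure.finsetSum_apply, measure_univ,
    Finset.sum_const, Finset.card_range, smul_eq_mul, nsmul_eq_mul, mul_one]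
  exact ENNReal.inv_mul_cancel (by simp) (ENNReal.natCast_ne_top _)

/-- Realises all partial convolutions on one probability space, so that weak convergence follows
from almost sure convergence. -/
theorem partialConv_eq_map_infinitePi [MeasurableMul₂ G] (ρ : ℕ → Measure G)
    [∀ k, IsProbabilityMeasure (ρ k)] (n : ℕ) :
    partialConv ρ n = (Measure.infinitePi fun i => ρ (i + 1)).map
      fun ω => ∏ i ∈ Finset.range n, ω i := by
  induction n with
  | zero => simp [partialConv]
  | succ n ih =>
    have hind := (ProbabilityTheory.iIndepFun_infinitePi (P := fun i => ρ (i + 1))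
      (X := fun _ x => x) (fun _ => measurable_id)).indepFun_prod_range_succ
      (fun i => measurable_pi_apply i) n
    have h := hind.map_mul_eq_map_mconv_map (by fun_prop) (measurable_pi_apply n)
    rw [partialConv, ih]
    have e : (Measure.infinitePi fun i => ρ (i + 1)).map (fun ω => ω n) = ρ (n + 1) :=
      Measure.infinitePi_map_eval _ n
    rw [e] at h
    have e1 : (∏ j ∈ Finset.range n, fun ω : ℕ → G => ω j) =
      fun ω => ∏ i ∈ Finset.range n, ω i := by ext; simp
    rw [e1] at h
    rw [← h]
    congr 1
    ext ω
    simp [Finset.prod_range_succ]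

theorem isProbabilityMeasure_update_dirac (ρ : ℕ → Measure G)
    [∀ k, IsProbabilityMeasure (ρ k)] (k i : ℕ) :
    IsProbabilityMeasure (Function.update ρ k (Measure.dirac 1) i) := by
  rcases eq_or_ne i k with rfl | h
  · simp only [Function.update_self]; infer_instance
  · simp only [Function.update_of_ne h]; infer_instance

/-- Replacing the factor by `δ_1` instead of deleting it keeps the indexing intact. -/
theorem partialConv_eq_mconv_update [MeasurableMul₂ G] (ρ : ℕ → Measure G)
    [∀ k, IsProbabilityMeasure (ρ k)] {k n : ℕ} (hk : 1 ≤ k) (hkn : k ≤ n) :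
    partialConv ρ n = ρ k ∗ₘ partialConv (Function.update ρ k (Measure.dirac 1)) n := by
  have := isProbabilityMeasure_update_dirac ρ k
  have hlt : ∀ m < k, partialConv (Function.update ρ k (Measure.dirac 1)) m = partialConv ρ m := by
    intro m hm
    induction m with
    | zero => rfl
    | succ m ih => rw [partialConv, partialConv, ih (by omega), Function.update_of_ne hm.ne]
  induction n, hkn using Nat.le_induction with
  | base =>
    obtain ⟨m, rfl⟩ : ∃ m, k = m + 1 := ⟨k - 1, by omega⟩
    rw [partialConv, partialConv, hlt m (by omega), Function.update_self, Measure.mconv_dirac_one,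
      Measure.mconv_comm]
  | succ n hn ih =>
    rw [partialConv, partialConv, ih, Function.update_of_ne (by omega), Measure.mconv_assoc]

theorem ae_mconv [MeasurableMul₂ G] {μ ν : Measure G} [SFinite μ] [SFinite ν] {s t u : Set G}
    (hs : ∀ᵐ x ∂μ, x ∈ s) (ht : ∀ᵐ x ∂ν, x ∈ t) (hu : MeasurableSet u)
    (h : ∀ x ∈ s, ∀ y ∈ t, x * y ∈ u) : ∀ᵐ x ∂(μ ∗ₘ ν), x ∈ u := by
  refine (ae_map_iff (by fun_prop) hu).2 ?_
  have h1 := Measure.quasiMeasurePreserving_fst (μ := μ) (ν := ν) |>.ae hs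
  have h2 := Measure.quasiMeasurePreserving_snd (μ := μ) (ν := ν) |>.ae ht
  filter_upwards [h1, h2] with z hz1 hz2 using h _ hz1 _ hz2

/-- Convolving the average of the first `k + 1` convolution powers with the measure once more
moves it by at most `1 / (k + 1)`. -/
theorem abs_real_mconv_avgConvPow_sub_le [MeasurableMul₂ G] (ν : ℕ → Measure G)
    [∀ k, IsProbabilityMeasure (ν k)] (τ : Measure G) [IsProbabilityMeasure τ] (k : ℕ)
    (A : Set G) :
    |(ν k ∗ₘ (avgConvPow ν k ∗ₘ τ)).real A - (avgConvPow ν k ∗ₘ τ).real A| ≤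
      1 / ((k : ℝ) + 1) := by
  -- The telescoping identity, written additively because measures cannot be subtracted.
  have hsum : ∀ n : ℕ, ν k ∗ₘ ((∑ i ∈ Finset.range n, convPow (ν k) i) ∗ₘ τ) + τ =
      (∑ i ∈ Finset.range n, convPow (ν k) i) ∗ₘ τ + convPow (ν k) n ∗ₘ τ := by
    intro n
    induction n with
    | zero => simp [convPow]
    | succ n ih =>
      rw [Finset.sum_range_succ, Measure.add_mconv, Measure.mconv_add, add_right_comm, ih]
      congr 1
      rw [convPow, Measure.mconv_comm (convPow (ν k) n) (ν k), Measure.mconv_assoc]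
  have hc : ((k + 1 : ℕ) : ℝ≥0∞) ≠ 0 := by simp
  have hc' : ((k + 1 : ℕ) : ℝ≥0∞) ≠ ∞ := ENNReal.natCast_ne_top _
  have e : ∑ i ∈ Finset.range (k + 1), convPow (ν k) i =
      ((k + 1 : ℕ) : ℝ≥0∞) • avgConvPow ν k := by
    rw [avgConvPow, smul_smul, ENNReal.mul_inv_cancel hc hc', one_smul]
  have h := hsum (k + 1)
  rw [e, Measure.mconv_smul_left, Measure.mconv_smul_right] at h
  have h' := congrArg (fun m : Measure G => m.real A) h
  have : ∀ m : Measure G, ∀ [IsFiniteMeasure m],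
      IsFiniteMeasure (((k + 1 : ℕ) : ℝ≥0∞) • m) := fun m _ => m.smul_finite hc'
  rw [measureReal_add_apply, measureReal_add_apply, measureReal_ennreal_smul_apply,
    measureReal_ennreal_smul_apply, ENNReal.toReal_natCast] at h'
  push_cast at h'
  have b1 : τ.real A ≤ 1 := measureReal_le_one
  have b2 : (convPow (ν k) (k + 1) ∗ₘ τ).real A ≤ 1 := measureReal_le_one
  have b3 : 0 ≤ τ.real A := measureReal_nonneg
  have b4 : 0 ≤ (convPow (ν k) (k + 1) ∗ₘ τ).real A := measureReal_nonneg
  have hk : (0 : ℝ) < k + 1 := by positivity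
  rw [abs_le, neg_le, le_div_iff₀ hk, le_div_iff₀ hk]
  constructor <;> nlinarith

end Convolution

/-! ### Infinite convolutions under an invariant metric -/

section InvariantMetric

variable {G : Type*} [CommGroup G] [MetricSpace G] [IsIsometricSMul G G] [IsTopologicalGroup G]
  [PolishSpace G] [MeasurableSpace G] [BorelSpace G]

theorem exists_isInfiniteConvolution (ρ : ℕ → Measure G) [∀ k, IsProbabilityMeasure (ρ k)]
    (hρ : ∀ k, 1 ≤ k → ∀ᵐ x ∂(ρ k), dist x 1 ≤ (1 / 2 : ℝ) ^ k) :
    ∃ σ, IsInfiniteConvolution ρ σ := by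
  have := completeSpace_of_isIsometricSMul G
  set P := Measure.infinitePi fun i => ρ (i + 1) with hP
  have hae : ∀ᵐ ω ∂P, ∀ i : ℕ, dist (ω i) 1 ≤ (1 / 2 : ℝ) ^ i := by
    refine ae_all_iff.2 fun i => ?_
    have h := (measurePreserving_eval_infinitePi (fun i => ρ (i + 1)) i).quasiMeasurePreserving.ae
      (hρ (i + 1) (by omega))
    filter_upwards [h] with ω hω
    exact hω.trans (pow_le_pow_of_le_one (by norm_num) (by norm_num) (by omega))
  have hmeas : ∀ n : ℕ, Measurable fun ω : ℕ → G => ∏ i ∈ Finset.range n, ω i := fun n => by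
    fun_prop
  obtain ⟨X, hX, hlim⟩ := measurable_limit_of_tendsto_metrizable_ae (L := atTop) (μ := P)
    (fun n => (hmeas n).aemeasurable) (hae.mono fun ω hω => exists_tendsto_prod_range ω hω)
  refine ⟨P.map X, Measure.isProbabilityMeasure_map hX.aemeasurable, fun f => ?_⟩
  have hf : StronglyMeasurable f := f.continuous.stronglyMeasurable
  rw [integral_map hX.aemeasurable hf.aestronglyMeasurable]
  refine (tendsto_integral_of_dominated_convergence (μ := P)
    (F := fun n ω => f (∏ i ∈ Finset.range n, ω i)) (fun _ => ‖f‖)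
    (fun n => (hf.comp_measurable (hmeas n)).aestronglyMeasurable) (integrable_const _)
    (fun n => ae_of_all _ fun ω => f.norm_coe_le_norm _)
    (hlim.mono fun ω hω => (f.continuous.tendsto _).comp hω)).congr fun n => ?_
  rw [partialConv_eq_map_infinitePi, integral_map (hmeas n).aemeasurable hf.aestronglyMeasurable]

theorem exists_eq_mconv_of_isInfiniteConvolution (ρ : ℕ → Measure G)
    [∀ k, IsProbabilityMeasure (ρ k)]
    (hρ : ∀ k, 1 ≤ k → ∀ᵐ x ∂(ρ k), dist x 1 ≤ (1 / 2 : ℝ) ^ k) {σ : Measure G}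
    (hσ : IsInfiniteConvolution ρ σ) {k : ℕ} (hk : 1 ≤ k) :
    ∃ τ : Measure G, IsProbabilityMeasure τ ∧ σ = ρ k ∗ₘ τ := by
  have hprob := isProbabilityMeasure_update_dirac ρ k
  -- `τ` is the infinite convolution of all the factors except `ρ k`.
  obtain ⟨τ, hτ, hlim⟩ := exists_isInfiniteConvolution (Function.update ρ k (Measure.dirac 1))
    fun i hi => by
      rcases eq_or_ne i k with rfl | h
      · rw [Function.update_self, ae_dirac_iff (measurableSet_le (by fun_prop) (by fun_prop))]
        simp
      · rw [Function.update_of_ne h]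
        exact hρ i hi
  obtain ⟨hσ1, hσlim⟩ := hσ
  refine ⟨τ, hτ, ext_of_forall_integral_eq_of_IsFiniteMeasure fun f => ?_⟩
  have hint : ∀ m : Measure G, ∀ [IsFiniteMeasure m], Integrable f m := fun m _ => f.integrable m
  refine tendsto_nhds_unique (hσlim f) ?_
  rw [integral_mconv (hint _)]
  have hmeas : ∀ m : Measure G, ∀ [IsFiniteMeasure m],
      AEStronglyMeasurable (fun x => ∫ y, f (x * y) ∂m) (ρ k) := fun m _ =>
    ((f.continuous.stronglyMeasurable.comp_measurable
      measurable_mul).integral_prod_right' (ν := m)).aestronglyMeasurable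
  refine (tendsto_integral_of_dominated_convergence (μ := ρ k)
    (F := fun n x => ∫ y, f (x * y) ∂(partialConv (Function.update ρ k (Measure.dirac 1)) n))
    (fun _ => ‖f‖) (fun n => hmeas _) (integrable_const _)
    (fun n => ae_of_all _ fun x => ?_) (ae_of_all _ fun x => ?_)).congr' ?_
  · refine (norm_integral_le_of_norm_le_const (ae_of_all _ fun y => f.norm_coe_le_norm _)).trans ?_
    simp
  · exact hlim (f.compContinuous ⟨fun y => x * y, by fun_prop⟩)
  · filter_upwards [eventually_ge_atTop k] with n hn
    rw [partialConv_eq_mconv_update ρ hk hn, integral_mconv (hint _)]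

theorem ae_dist_convPow_le {μ : Measure G} [IsProbabilityMeasure μ] {ε : ℝ}
    (h : ∀ᵐ x ∂μ, dist x 1 ≤ ε) (i : ℕ) : ∀ᵐ x ∂(convPow μ i), dist x 1 ≤ i * ε := by
  have hball : ∀ r : ℝ, MeasurableSet {x : G | dist x 1 ≤ r} := fun r =>
    measurableSet_le (by fun_prop) (by fun_prop)
  induction i with
  | zero =>
    rw [convPow, ae_dirac_iff (hball _)]
    simp
  | succ i ih =>
    refine ae_mconv (s := {x | dist x 1 ≤ i * ε}) (t := {x | dist x 1 ≤ ε}) ih h (hball _)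
      fun x hx y hy => ?_
    have h1 : dist (x * y) (x * 1) = dist y 1 := dist_mul_left x y 1
    rw [mul_one] at h1
    have h2 := dist_triangle (x * y) x 1
    have hx' : dist x 1 ≤ i * ε := hx
    have hy' : dist y 1 ≤ ε := hy
    show dist (x * y) 1 ≤ ((i + 1 : ℕ) : ℝ) * ε
    push_cast
    linarith

/-- The factor `k + 1` is what the denominator of the radius `1/(2^k (k+1))` cancels. -/
theorem ae_dist_avgConvPow_le (ν : ℕ → Measure G) [∀ k, IsProbabilityMeasure (ν k)] {ε : ℝ}
    {k : ℕ} (hε : 0 ≤ ε) (h : ∀ᵐ x ∂(ν k), dist x 1 ≤ ε) :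
    ∀ᵐ x ∂(avgConvPow ν k), dist x 1 ≤ (k + 1) * ε := by
  refine Measure.ae_smul_measure ?_ _
  rw [← Measure.sum_coe_finset]
  refine Measure.ae_sum_iff.2 fun i => ?_
  filter_upwards [ae_dist_convPow_le h i] with x hx
  refine hx.trans (mul_le_mul_of_nonneg_right ?_ hε)
  exact_mod_cast (Finset.mem_range.1 i.2).le

/-- If the probability measures `ν k` live on balls around `1` that shrink fast enough, then the
infinite convolution of the averages of their convolution powers exists and is asymptotically
invariant under convolution with `ν k`. -/
theorem exists_isInfiniteConvolution_isSoleckiMeasure (μ ν : ℕ → Measure G)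
    [∀ k, IsProbabilityMeasure (ν k)] (hνμ : ∀ k, ν k ≪ μ k)
    (hν : ∀ k : ℕ, 1 ≤ k → ∀ᵐ x ∂(ν k), dist x 1 ≤ 1 / ((2 : ℝ) ^ k * ((k : ℝ) + 1))) :
    ∃ σ, IsInfiniteConvolution (avgConvPow ν) σ ∧ IsSoleckiMeasure μ σ ν := by
  have hρ : ∀ k : ℕ, 1 ≤ k → ∀ᵐ x ∂(avgConvPow ν k), dist x 1 ≤ (1 / 2 : ℝ) ^ k := by
    intro k hk
    filter_upwards [ae_dist_avgConvPow_le ν (by positivity) (hν k hk)] with x hx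
    refine hx.trans_eq ?_
    rw [one_div_pow]
    field_simp
  obtain ⟨σ, hσ⟩ := exists_isInfiniteConvolution (avgConvPow ν) hρ
  have hσ1 : IsProbabilityMeasure σ := hσ.1
  refine ⟨σ, hσ, hσ1, inferInstance, hνμ, fun K _ => ?_⟩
  rw [← ENNReal.tendsto_toReal_iff (fun k => measure_ne_top _ _) (measure_ne_top _ _)]
  rw [tendsto_iff_dist_tendsto_zero]
  refine squeeze_zero' (Eventually.of_forall fun _ => dist_nonneg) ?_
    tendsto_one_div_add_atTop_nhds_zero_nat
  filter_upwards [eventually_ge_atTop 1] with k hk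
  obtain ⟨τ, hτ, hστ⟩ := exists_eq_mconv_of_isInfiniteConvolution (avgConvPow ν) hρ hσ hk
  rw [hστ]
  exact abs_real_mconv_avgConvPow_sub_le ν τ k K

end InvariantMetric

/-! ### Existence of an invariant metric -/

section ExistenceOfMetric

/-- Birkhoff–Kakutani for abelian groups. -/
theorem exists_isLeftInvariantMetric (G : Type*) [CommGroup G] [τ : TopologicalSpace G]
    [IsTopologicalGroup G] [TopologicalSpace.MetrizableSpace G] :
    ∃ d : MetricSpace G, IsLeftInvariantMetric d := by
  let := IsTopologicalGroup.rightUniformSpace G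
  have := isUniformGroup_of_commGroup (G := G)
  have := IsUniformGroup.uniformity_countably_generated (α := G)
  let := UniformSpace.metricSpace G
  -- Truncation at `1` makes the supremum over translates finite; the supremum makes `D` invariant.
  set e : G → G → ℝ := fun x y => min (dist x y) 1 with he
  set D : G → G → ℝ := fun x y => ⨆ g : G, e (g * x) (g * y) with hD
  have hbdd : ∀ x y, BddAbove (Set.range fun g : G => e (g * x) (g * y)) := fun x y =>
    ⟨1, by rintro _ ⟨g, rfl⟩; exact min_le_right _ _⟩
  have hle : ∀ x y g, e (g * x) (g * y) ≤ D x y := fun x y g => le_ciSup (hbdd x y) g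
  have hle' : ∀ x y, e x y ≤ D x y := fun x y => by simpa using hle x y 1
  have hself : ∀ x, D x x = 0 := fun x => by simp [hD, he]
  have hcomm : ∀ x y, D x y = D y x := fun x y => by simp only [hD, he, dist_comm]
  have htri : ∀ x y z, D x z ≤ D x y + D y z := fun x y z => by
    refine ciSup_le fun g => ?_
    refine le_trans ?_ (add_le_add (hle x y g) (hle y z g))
    have h := dist_triangle (g * x) (g * y) (g * z)
    have h1 : 0 ≤ dist (g * x) (g * y) := dist_nonneg
    have h2 : 0 ≤ dist (g * y) (g * z) := dist_nonneg
    simp only [he]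
    rcases min_cases (dist (g * x) (g * z)) 1 with ⟨ha, _⟩ | ⟨ha, _⟩ <;>
    rcases min_cases (dist (g * x) (g * y)) 1 with ⟨hb, _⟩ | ⟨hb, _⟩ <;>
    rcases min_cases (dist (g * y) (g * z)) 1 with ⟨hc, _⟩ | ⟨hc, _⟩ <;>
    rw [ha, hb, hc] <;> linarith
  have heq : ∀ x y, D x y = 0 → x = y := fun x y h => by
    have h1 := (hle' x y).trans_eq h
    rcases min_le_iff.1 h1 with h2 | h2
    · exact dist_le_zero.1 h2
    · norm_num at h2
  have hopen : ∀ s : Set G, IsOpen s ↔ ∀ x ∈ s, ∃ ε > 0, ∀ y, D x y < ε → y ∈ s := by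
    intro s
    refine ⟨fun hs x hx => ?_, fun h => isOpen_iff_mem_nhds.2 fun x hx => ?_⟩
    · obtain ⟨ε, hε, hs⟩ := Metric.isOpen_iff.1 hs x hx
      refine ⟨min ε 1, by positivity, fun y hy => hs ?_⟩
      have h1 := (hle' x y).trans_lt hy
      rw [Metric.mem_ball, dist_comm]
      rcases min_lt_iff.1 h1 with h2 | h2
      · exact h2.trans_le (min_le_left _ _)
      · exact absurd h2 (not_lt.2 (min_le_right _ _))
    · obtain ⟨ε, hε, hs⟩ := h x hx
      have hU := Metric.dist_mem_uniformity (α := G) (half_pos hε)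
      rw [uniformity_eq_comap_nhds_one] at hU
      obtain ⟨U, hU, hUs⟩ := hU
      have hxU : (fun y : G => y / x) ⁻¹' U ∈ 𝓝 x :=
        (continuous_id.div_const x).continuousAt.preimage_mem_nhds (by simpa using hU)
      filter_upwards [hxU] with y hy
      refine hs y (lt_of_le_of_lt (ciSup_le fun g => ?_) (half_lt_self hε))
      refine (min_le_left _ _).trans (le_of_lt ?_)
      -- By commutativity `(g * y) / (g * x) = y / x`, so one neighbourhood serves every `g`.
      exact @hUs (g * x, g * y) (by simpa using hy)
  refine ⟨MetricSpace.ofDistTopology D hself hcomm htri hopen heq, rfl, fun h x y => ?_⟩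
  change D (h * x) (h * y) = D x y
  simp only [hD, ← mul_assoc]
  exact (Equiv.mulRight h).iSup_comp (g := fun g => e (g * x) (g * y))

end ExistenceOfMetric

/-! ### The measures of a null sequence, and the conclusion -/

section SeqMeasure

variable {G : Type*} [Group G] [MeasurableSpace G]

theorem tsum_half_pow_succ : ∑' i : ℕ, ((2 : ℝ≥0∞)⁻¹ ^ (i + 1)) = 1 := by
  simp_rw [pow_succ]
  rw [ENNReal.tsum_mul_right, ENNReal.tsum_geometric, ENNReal.one_sub_inv_two, inv_inv]
  exact ENNReal.mul_inv_cancel (by simp) (by simp)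

instance isProbabilityMeasure_seqMeasure (t : ℕ → G) (k : ℕ) :
    IsProbabilityMeasure (seqMeasure t k) := by
  constructor
  simp [seqMeasure, Measure.sum_apply, tsum_half_pow_succ]

theorem hasConcentrationProperty_seqMeasure (t : ℕ → G) :
    HasConcentrationProperty t (seqMeasure t) := by
  -- Only `m ≥ k` is used, so the truncated `m - k` is harmless; the leading weight `1/2` gives `j =
  -- 0`, `α = 1/2`.
  refine ⟨fun k m => (2 : ℝ≥0)⁻¹ ^ (m - k + 1), fun k => ?_, fun k => ?_, 0, 2⁻¹, by positivity,
    Eventually.of_forall fun k => by simp⟩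
  · rw [← ENNReal.hasSum_coe]
    have h := (ENNReal.summable (f := fun i : ℕ => (2 : ℝ≥0∞)⁻¹ ^ (i + 1))).hasSum
    rw [tsum_half_pow_succ] at h
    simpa [-inv_pow, ENNReal.coe_inv] using h
  · simp [-inv_pow, seqMeasure, ENNReal.coe_inv]

end SeqMeasure

theorem ae_dist_seqMeasure_le {G : Type*} [CommGroup G] [MetricSpace G] [IsIsometricSMul G G]
    [IsTopologicalGroup G] [SecondCountableTopology G] [MeasurableSpace G] [BorelSpace G]
    {t : ℕ → G} {k : ℕ} {ε : ℝ} (h : ∀ m ≥ k, dist (t m) 1 ≤ ε) :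
    ∀ᵐ x ∂(seqMeasure t k), dist x 1 ≤ ε := by
  refine Measure.ae_sum_iff.2 fun i => Measure.ae_smul_measure ?_ _
  rw [ae_dirac_iff (measurableSet_le (by fun_prop) (by fun_prop))]
  have h1 := h (k + i) (by omega)
  rwa [← dist_inv_inv, inv_inv, inv_one]

theorem IsLeftInvariantMetric.exists_isInfiniteConvolution_isSoleckiMeasure {G : Type*}
    [CommGroup G] [TopologicalSpace G] [IsTopologicalGroup G] [PolishSpace G] [MeasurableSpace G]
    [BorelSpace G] {d : MetricSpace G} (hd : IsLeftInvariantMetric d) (μ ν : ℕ → Measure G)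
    [∀ k, IsProbabilityMeasure (ν k)] (hνμ : ∀ k, ν k ≪ μ k)
    (hν : ∀ k : ℕ, 1 ≤ k → ∀ᵐ x ∂(ν k), d.dist x 1 ≤ 1 / ((2 : ℝ) ^ k * ((k : ℝ) + 1))) :
    ∃ σ, IsInfiniteConvolution (avgConvPow ν) σ ∧ IsSoleckiMeasure μ σ ν := by
  -- Substituting the topology of `d` for the given one lets `d` serve as the metric instance.
  obtain ⟨rfl, hinv⟩ := hd
  have : IsIsometricSMul G G := ⟨fun g => Isometry.of_dist_eq fun x y => hinv g x y⟩
  exact StrongAmenability.exists_isInfiniteConvolution_isSoleckiMeasure μ ν hνμ hν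

theorem IsLeftInvariantMetric.ae_dist_seqMeasure_le {G : Type*}
    [CommGroup G] [TopologicalSpace G] [IsTopologicalGroup G] [PolishSpace G] [MeasurableSpace G]
    [BorelSpace G] {d : MetricSpace G} (hd : IsLeftInvariantMetric d) {t : ℕ → G}
    (ht : IsRegularNullSeq d t) {k : ℕ} (hk : 1 ≤ k) :
    ∀ᵐ x ∂(seqMeasure t k), d.dist x 1 ≤ 1 / ((2 : ℝ) ^ k * ((k : ℝ) + 1)) := by
  obtain ⟨rfl, hinv⟩ := hd
  have : IsIsometricSMul G G := ⟨fun g => Isometry.of_dist_eq fun x y => hinv g x y⟩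
  exact StrongAmenability.ae_dist_seqMeasure_le fun m hm =>
    (ht.norm_antitone k m hk hm).trans (ht.norm_le k hk)

theorem amenableAtOne_of_commGroup (G : Type*) [CommGroup G] [TopologicalSpace G]
    [IsTopologicalGroup G] [PolishSpace G] [MeasurableSpace G] [BorelSpace G] :
    AmenableAtOne G := by
  intro μ hμ hsupp
  obtain ⟨d, hd⟩ := exists_isLeftInvariantMetric G
  set B : ℕ → Set G := fun k => {x | d.dist x 1 < 1 / ((2 : ℝ) ^ k * ((k : ℝ) + 1))} with hB
  have hBopen : ∀ k, IsOpen (B k) := by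
    obtain ⟨rfl, -⟩ := hd
    exact fun k => Metric.isOpen_ball
  have hBone : ∀ k, (1 : G) ∈ B k := fun k => by
    have : d.dist 1 1 = 0 := d.dist_self 1
    simp only [hB, Set.mem_ofPred_eq, this]
    positivity
  have hpos : ∀ k, μ k (B k) ≠ 0 := fun k =>
    ((Measure.mem_support_iff_forall _).1 (hsupp k) _ ((hBopen k).mem_nhds (hBone k))).ne'
  have : ∀ k, IsProbabilityMeasure (ProbabilityTheory.cond (μ k) (B k)) := fun k =>
    ProbabilityTheory.cond_isProbabilityMeasure (hpos k)
  obtain ⟨σ, -, hσ⟩ := hd.exists_isInfiniteConvolution_isSoleckiMeasure μ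
    (fun k => ProbabilityTheory.cond (μ k) (B k))
    (fun k => ProbabilityTheory.cond_absolutelyContinuous)
    fun k _ => (ProbabilityTheory.ae_cond_mem (hBopen k).measurableSet).mono fun x hx => le_of_lt hx
  exact ⟨σ, _, hσ⟩

end StrongAmenability

theorem theorem4 (G : Type*) [CommGroup G] [TopologicalSpace G] [IsTopologicalGroup G]
    [PolishSpace G] [MeasurableSpace G] [BorelSpace G] :
    StrongAmenability.StronglyAmenableAtOne G ∧
    ∀ d : MetricSpace G, StrongAmenability.IsLeftInvariantMetric d →
      ∀ t : ℕ → G, StrongAmenability.IsRegularNullSeq d t →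
        ∃ σ : Measure G,
          StrongAmenability.IsInfiniteConvolution
            (StrongAmenability.avgConvPow (StrongAmenability.seqMeasure t)) σ ∧
          StrongAmenability.IsSoleckiMeasure (StrongAmenability.seqMeasure t) σ
            (StrongAmenability.seqMeasure t) ∧
          StrongAmenability.HasConcentrationProperty t (StrongAmenability.seqMeasure t) := by
  open StrongAmenability in
  have key : ∀ d : MetricSpace G, IsLeftInvariantMetric d → ∀ t : ℕ → G, IsRegularNullSeq d t →
      ∃ σ : Measure G, IsInfiniteConvolution (avgConvPow (seqMeasure t)) σ ∧
        IsSoleckiMeasure (seqMeasure t) σ (seqMeasure t) ∧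
        HasConcentrationProperty t (seqMeasure t) := by
    intro d hd t ht
    obtain ⟨σ, hσ, hsol⟩ := hd.exists_isInfiniteConvolution_isSoleckiMeasure (seqMeasure t)
      (seqMeasure t) (fun k => Measure.AbsolutelyContinuous.rfl)
      fun k hk => hd.ae_dist_seqMeasure_le ht hk
    exact ⟨σ, hσ, hsol, hasConcentrationProperty_seqMeasure t⟩
  refine ⟨⟨StrongAmenability.amenableAtOne_of_commGroup G, fun d hd t ht => ?_⟩, key⟩
  obtain ⟨σ, -, hsol, hconc⟩ := key d hd t ht
  exact ⟨σ, _, hsol, hconc⟩
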